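/- Let $R$ be an associative ring with identity. Suppose that $R$ is simple (that is, $R \neq 0$ and its only two-sided ideals are $0$ and $R$) and right Goldie, i.e. $R$ satisfies the ascending chain condition on right annihilators $\{x \in R : sx = 0 \text{ for all } s \in S\}$ of subsets $S \subseteq R$, and there is no infinite sequence of nonzero right ideals of $R$ whose sum is direct (equivalently, $R$ has finite uniform dimension as a right module over itself). Suppose further that $R$ has the 2-nil-sum property: every element of $R$ that is not a central unit (a unit lying in the center of $R$) is a sum of two nilpotent elements of $R$. Then $R$ is a (commutative) field. -/

import Mathlib

/-- The right annihilator `{x | ∀ s ∈ S, s * x = 0}` of a subset `S` of `R`, as a right ideal of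
`R`. Right ideals of `R` are the submodules of `R` over the opposite ring, which acts on `R` by
right multiplication. -/
def rightAnnihilator {R : Type*} [Ring R] (S : Set R) : Submodule Rᵐᵒᵖ R where
  carrier := {x | ∀ s ∈ S, s * x = 0}
  add_mem' := fun {x y} hx hy s hs => by rw [mul_add, hx s hs, hy s hs, add_zero]
  zero_mem' := fun s _ => mul_zero s
  smul_mem' := fun c x hx s hs => by
    rw [← MulOpposite.op_unop c, op_smul_eq_mul, ← mul_assoc, hx s hs, zero_mul]

/-- A ring is right Goldie if it has the ascending chain condition on right annihilators of
subsets, and finite uniform dimension as a right module over itself: there is no infinite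
sequence of nonzero right ideals whose sum is direct. -/
structure IsRightGoldie (R : Type*) [Ring R] : Prop where
  acc_rightAnnihilator : ∀ S : ℕ → Set R, Monotone (fun n => rightAnnihilator (S n)) →
    ∃ n, ∀ m, n ≤ m → rightAnnihilator (S m) = rightAnnihilator (S n)
  no_infinite_direct_sum : ¬ ∃ I : ℕ → Submodule Rᵐᵒᵖ R, (∀ n, I n ≠ ⊥) ∧ iSupIndep I

/-- The 2-nil-sum property: every element that is not a central unit is the sum of two
nilpotent elements. -/
def TwoNilSumProperty (R : Type*) [Ring R] : Prop :=
  ∀ a : R, ¬ (IsUnit a ∧ a ∈ Subring.center R) →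
    ∃ b c : R, IsNilpotent b ∧ IsNilpotent c ∧ a = b + c

/-! Finite uniform dimension gives a uniform right ideal `U`, and simplicity gives `a ∈ U` with `a *
a ≠ 0`. Simplicity also makes `R` right nonsingular, so `a * x * a * y * a = 0` forces `a * x * a =
0` or `a * y * a = 0`. This prevents `a` from being a sum of two nilpotents
(`mul_self_eq_zero_of_eq_add_nilpotent`), so `a` is a central unit. Cancelling it makes `R` a
domain, where 0 is the only nilpotent and every nonzero element is therefore a central unit. -/

/-- A submodule is uniform if it is nonzero and any two of its nonzero submodules meet
nontrivially. -/
def Submodule.IsUniform {R M : Type*} [Ring R] [AddCommGroup M] [Module R M]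
    (U : Submodule R M) : Prop :=
  U ≠ ⊥ ∧ ∀ A B : Submodule R M, A ≤ U → B ≤ U → A ≠ ⊥ → B ≠ ⊥ → ¬ Disjoint A B

/-- In a vanishing sum, all terms but the one of least index `a` lie in `B a`, so that term lies in
`A a ⊓ B a` and is zero. -/
theorem iSupIndep_of_disjoint_of_antitone {R M : Type*} [Ring R] [AddCommGroup M] [Module R M]
    {A B : ℕ → Submodule R M} (hB : Antitone B) (hd : ∀ n, Disjoint (A n) (B n))
    (hle : ∀ n, A (n + 1) ≤ B n) : iSupIndep A := by
  rw [iSupIndep_iff_finsetSum_eq_zero_imp_eq_zero]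
  intro s
  induction s using Finset.induction_on_min with
  | empty => simp
  | insert a s ha ih =>
    intro f hf hsum
    have has : a ∉ s := fun h => lt_irrefl _ (ha a h)
    rw [Finset.sum_insert has] at hsum
    have hmem : ∑ i ∈ s, f i ∈ B a := by
      refine Submodule.sum_mem _ fun i hi => ?_
      obtain ⟨k, rfl⟩ : ∃ k, i = k + 1 := ⟨i - 1, by have := ha i hi; omega⟩
      exact hB (Nat.lt_succ_iff.1 (ha _ hi)) (hle k (hf _ (Finset.mem_insert_of_mem hi)))
    have h0 : f a = 0 := by
      refine Submodule.disjoint_def.1 (hd a) _ (hf a (Finset.mem_insert_self _ _)) ?_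
      rw [eq_neg_of_add_eq_zero_left hsum]
      exact neg_mem hmem
    rw [h0, zero_add] at hsum
    intro i hi
    rcases Finset.mem_insert.1 hi with rfl | hi
    · exact h0
    · exact ih f (fun j hj => hf j (Finset.mem_insert_of_mem hj)) hsum i hi

theorem Submodule.exists_isUniform {R M : Type*} [Ring R] [AddCommGroup M] [Module R M]
    [Nontrivial M] (h : ¬ ∃ I : ℕ → Submodule R M, (∀ n, I n ≠ ⊥) ∧ iSupIndep I) :
    ∃ U : Submodule R M, U.IsUniform := by
  by_contra! hU
  have split : ∀ C : {C : Submodule R M // C ≠ ⊥}, ∃ A B : {C : Submodule R M // C ≠ ⊥},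
      A.1 ≤ C.1 ∧ B.1 ≤ C.1 ∧ Disjoint A.1 B.1 := by
    intro C
    have hC := hU C.1
    simp only [Submodule.IsUniform, not_and, not_forall, not_not] at hC
    obtain ⟨A, B, hA, hB, hA0, hB0, hAB⟩ := hC C.2
    exact ⟨⟨A, hA0⟩, ⟨B, hB0⟩, hA, hB, hAB⟩
  choose F G hF hG hFG using split
  -- Split repeatedly: set `F (C n)` aside and continue inside `G (C n)`.
  let C : ℕ → {C : Submodule R M // C ≠ ⊥} := fun n => G^[n] ⟨⊤, top_ne_bot⟩
  have hC : ∀ n, C (n + 1) = G (C n) := fun n => Function.iterate_succ_apply' G n _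
  refine h ⟨fun n => (F (C n)).1, fun n => (F (C n)).2,
    iSupIndep_of_disjoint_of_antitone (B := fun n => (C (n + 1)).1) ?_ ?_ fun n => hF _⟩
  · refine antitone_nat_of_succ_le fun n => ?_
    rw [hC (n + 1)]
    exact hG _
  · intro n
    simp only [hC n]
    exact hFG _

/-- A simple ring is right nonsingular: an element whose right annihilator is essential as a
right ideal vanishes. -/
theorem IsSimpleRing.eq_zero_of_essential_annihilator {R : Type*} [Ring R] [IsSimpleRing R]
    {z : R} (hz : ∀ w : R, w ≠ 0 → ∃ s, w * s ≠ 0 ∧ z * (w * s) = 0) : z = 0 := by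
  by_contra hz0
  -- The right singular ideal; it is proper, since 1 annihilates nothing nonzero.
  let Z : TwoSidedIdeal R := TwoSidedIdeal.mk'
    {z | ∀ w : R, w ≠ 0 → ∃ s, w * s ≠ 0 ∧ z * (w * s) = 0}
    (fun w hw => ⟨1, by simpa using hw, zero_mul _⟩)
    (by
      intro x y hx hy w hw
      obtain ⟨s, hs, hxs⟩ := hx w hw
      obtain ⟨t, ht, hyt⟩ := hy _ hs
      refine ⟨s * t, by rwa [← mul_assoc], ?_⟩
      rw [← mul_assoc w, add_mul, hyt, ← mul_assoc x, hxs, zero_mul, add_zero])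
    (by
      intro x hx w hw
      obtain ⟨s, hs, hxs⟩ := hx w hw
      exact ⟨s, hs, by rw [neg_mul, hxs, neg_zero]⟩)
    (by
      intro x y hy w hw
      obtain ⟨s, hs, hys⟩ := hy w hw
      exact ⟨s, hs, by rw [mul_assoc, hys, mul_zero]⟩)
    (by
      intro x y hx w hw
      by_cases hyw : y * w = 0
      · exact ⟨1, by simpa using hw, by rw [mul_one, mul_assoc, hyw, mul_zero]⟩
      · obtain ⟨s, hs, hxs⟩ := hx _ hyw
        refine ⟨s, fun h => hs ?_, ?_⟩
        · rw [mul_assoc, h, mul_zero]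
        · rw [mul_assoc, ← mul_assoc y, hxs])
  have h1 : (1 : R) ∈ Z :=
    IsSimpleRing.one_mem_of_ne_zero_mem Z hz0 ((TwoSidedIdeal.mem_mk' _ _ _ _ _ _ _).2 hz)
  obtain ⟨s, hs, h⟩ := (TwoSidedIdeal.mem_mk' _ _ _ _ _ _ _).1 h1 1 one_ne_zero
  exact hs (by rwa [one_mul] at h)

/-- Semiprimeness: the right annihilator of `aR` is a two-sided ideal, and if it contains 1 then `a
= 0`. -/
theorem IsSimpleRing.eq_zero_of_forall_mul_mul_eq_zero {R : Type*} [Ring R] [IsSimpleRing R]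
    {a : R} (ha : ∀ x, a * x * a = 0) : a = 0 := by
  by_contra ha0
  let Z : TwoSidedIdeal R := TwoSidedIdeal.mk' {z | ∀ x, a * x * z = 0}
    (fun x => mul_zero _)
    (fun {y z} hy hz x => by rw [mul_add, hy x, hz x, add_zero])
    (fun {y} hy x => by rw [mul_neg, hy x, neg_zero])
    (fun {y z} hz x => by rw [← mul_assoc, mul_assoc a, hz])
    (fun {y z} hy x => by rw [← mul_assoc, hy, zero_mul])
  have h1 : (1 : R) ∈ Z :=
    IsSimpleRing.one_mem_of_ne_zero_mem Z ha0 ((TwoSidedIdeal.mem_mk' _ _ _ _ _ _ _).2 ha)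
  exact ha0 (by simpa using (TwoSidedIdeal.mem_mk' _ _ _ _ _ _ _).1 h1 1)

theorem Submodule.mul_mem_of_op {R : Type*} [Ring R] (U : Submodule Rᵐᵒᵖ R) {u : R} (hu : u ∈ U)
    (x : R) : u * x ∈ U := by
  simpa using U.smul_mem (MulOpposite.op x) hu

theorem Submodule.IsUniform.exists_mul_eq_mul {R : Type*} [Ring R] {U : Submodule Rᵐᵒᵖ R}
    (hU : U.IsUniform) {u v : R} (hu : u ∈ U) (hv : v ∈ U) (hu0 : u ≠ 0) (hv0 : v ≠ 0) :
    ∃ r s, u * r = v * s ∧ u * r ≠ 0 := by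
  have h := hU.2 (Submodule.span _ {u}) (Submodule.span _ {v})
    (by simpa using hu) (by simpa using hv) (by simpa using hu0) (by simpa using hv0)
  rw [Submodule.disjoint_def] at h
  push Not at h
  obtain ⟨x, hx, hx', hx0⟩ := h
  obtain ⟨r, rfl⟩ := Submodule.mem_span_singleton.1 hx
  obtain ⟨s, hs⟩ := Submodule.mem_span_singleton.1 hx'
  exact ⟨r.unop, s.unop, hs.symm, hx0⟩

/-- In a uniform right ideal of a simple ring, the homotope product `(x, y) ↦ x * a * y` induces
a product without zero divisors on `aRa`. -/
theorem Submodule.IsUniform.eq_zero_of_mul_eq_zero {R : Type*} [Ring R] [IsSimpleRing R]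
    {U : Submodule Rᵐᵒᵖ R} (hU : U.IsUniform) {a : R} (ha : a ∈ U) {x y : R}
    (h : a * x * a * y * a = 0) : a * x * a = 0 ∨ a * y * a = 0 := by
  rw [or_iff_not_imp_right]
  intro hy
  -- When `a * w ≠ 0`, uniformity moves it by some `r` to a nonzero element of `a * y * a * R`,
  -- which `a * x` kills.
  refine IsSimpleRing.eq_zero_of_essential_annihilator fun w hw => ?_
  by_cases haw : a * w = 0
  · exact ⟨1, by simpa using hw, by rw [mul_one, mul_assoc, haw, mul_zero]⟩
  · obtain ⟨r, s, hrs, hr⟩ := hU.exists_mul_eq_mul (U.mul_mem_of_op ha w)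
      (U.mul_mem_of_op (U.mul_mem_of_op ha y) a) haw hy
    refine ⟨r, fun h0 => hr (by rw [mul_assoc, h0, mul_zero]), ?_⟩
    calc a * x * a * (w * r) = a * x * (a * w * r) := by simp only [mul_assoc]
      _ = a * x * a * y * a * s := by rw [hrs]; simp only [mul_assoc]
      _ = 0 := by rw [h, zero_mul]

theorem Submodule.IsUniform.exists_mul_self_ne_zero {R : Type*} [Ring R] [IsSimpleRing R]
    {U : Submodule Rᵐᵒᵖ R} (hU : U.IsUniform) : ∃ a ∈ U, a * a ≠ 0 := by
  by_contra! h
  refine hU.1 ((Submodule.eq_bot_iff _).2 fun a ha =>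
    IsSimpleRing.eq_zero_of_forall_mul_mul_eq_zero fun x => ?_)
  have hax := U.mul_mem_of_op ha x
  -- Expanding `(a + a * x) ^ 2 = 0` leaves only `a * x * a`.
  have h1 := h _ (U.add_mem ha hax)
  have h2 : a * (a * x) = 0 := by rw [← mul_assoc, h a ha, zero_mul]
  rwa [add_mul, mul_add, mul_add, h a ha, h _ hax, h2, zero_add, zero_add, add_zero] at h1

theorem pow_succ_eq_add_sum {R : Type*} [Ring R] (b d : R) (n : ℕ) :
    b ^ (n + 1) = d ^ (n + 1) + ∑ i ∈ Finset.range (n + 1), d ^ i * (b - d) * b ^ (n - i) := by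
  induction n with
  | zero => simp
  | succ n ih =>
    rw [Finset.sum_range_succ, Nat.sub_self, pow_zero, mul_one]
    have : ∑ i ∈ Finset.range (n + 1), d ^ i * (b - d) * b ^ (n + 1 - i)
        = (∑ i ∈ Finset.range (n + 1), d ^ i * (b - d) * b ^ (n - i)) * b := by
      rw [Finset.sum_mul]
      refine Finset.sum_congr rfl fun i hi => ?_
      rw [Nat.succ_sub (Nat.lt_succ_iff.1 (Finset.mem_range.1 hi)), pow_succ, mul_assoc _ _ b]
    rw [this, ← sub_eq_of_eq_add' ih, pow_succ b (n + 1), pow_succ d (n + 1)]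
    noncomm_ring

theorem exists_greatest_mul_pow_mul_ne_zero {R : Type*} [Ring R] {a b : R} (hb : IsNilpotent b)
    (ha : a * a ≠ 0) : ∃ k, a * b ^ k * a ≠ 0 ∧ ∀ m, k < m → a * b ^ m * a = 0 := by
  classical
  obtain ⟨n, hn⟩ := hb
  have hP : a * b ^ 0 * a ≠ 0 := by simpa using ha
  refine ⟨Nat.findGreatest (fun k => a * b ^ k * a ≠ 0) n,
    Nat.findGreatest_spec (P := fun k => a * b ^ k * a ≠ 0) (Nat.zero_le n) hP, fun m hm => ?_⟩
  rcases le_total m n with hmn | hnm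
  · exact not_not.1 (Nat.findGreatest_is_greatest hm hmn)
  · rw [pow_eq_zero_of_le hnm hn, mul_zero, zero_mul]

/-- Put `d = -c`, so `b - d = a`, and expand `b ^ (k + l + 1) - d ^ (k + l + 1)` between two factors
`a`. With `k`, `l` the last exponents where `a * d ^ k * a` and `a * b ^ l * a` are nonzero, only `a
* d ^ k * a * b ^ l * a` survives, so it vanishes, against `ha`. -/
theorem mul_self_eq_zero_of_eq_add_nilpotent {R : Type*} [Ring R] {a b c : R}
    (ha : ∀ x y, a * x * a * y * a = 0 → a * x * a = 0 ∨ a * y * a = 0)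
    (hb : IsNilpotent b) (hc : IsNilpotent c) (h : a = b + c) : a * a = 0 := by
  by_contra h0
  obtain ⟨l, hl, hl'⟩ := exists_greatest_mul_pow_mul_ne_zero hb h0
  obtain ⟨k, hk, hk'⟩ := exists_greatest_mul_pow_mul_ne_zero hc.neg h0
  have key := congrArg (fun z => a * z * a) (pow_succ_eq_add_sum b (-c) (k + l))
  simp only [sub_neg_eq_add, ← h, mul_add, add_mul, Finset.mul_sum, Finset.sum_mul] at key
  rw [hl' _ (by omega), hk' _ (by omega), zero_add, Finset.sum_eq_single k] at key
  · rw [Nat.add_sub_cancel_left] at key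
    rcases ha ((-c) ^ k) (b ^ l) (by simpa only [mul_assoc] using key.symm) with h | h
    · exact hk h
    · exact hl h
  · intro i hi hik
    rcases lt_or_gt_of_ne hik with hlt | hgt
    · have := hl' (k + l - i) (by omega)
      rw [show a * ((-c) ^ i * a * b ^ (k + l - i)) * a
        = a * (-c) ^ i * (a * b ^ (k + l - i) * a) by simp only [mul_assoc], this, mul_zero]
    · rw [show a * ((-c) ^ i * a * b ^ (k + l - i)) * a
        = a * (-c) ^ i * a * (b ^ (k + l - i) * a) by simp only [mul_assoc], hk' i hgt, zero_mul]
  · intro hk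
    exact absurd (Finset.mem_range.2 (by omega)) hk

theorem TwoNilSumProperty.isField {R : Type*} [Ring R] [Nontrivial R] [NoZeroDivisors R]
    (hN : TwoNilSumProperty R) : IsField R := by
  have key : ∀ a : R, a ≠ 0 → IsUnit a ∧ a ∈ Subring.center R := by
    intro a ha
    by_contra hu
    obtain ⟨b, c, hb, hc, rfl⟩ := hN a hu
    exact ha (by rw [hb.eq_zero, hc.eq_zero, add_zero])
  refine ⟨exists_pair_ne R, fun x y => ?_, fun {a} ha => (key a ha).1.exists_right_inv⟩
  by_cases hx : x = 0
  · simp [hx]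
  · exact (Subring.mem_center_iff.1 (key x hx).2 y).symm

theorem theorem3p8 (R : Type*) [Ring R] [IsSimpleRing R] (hG : IsRightGoldie R)
    (hN : TwoNilSumProperty R) : IsField R := by
  obtain ⟨U, hU⟩ := Submodule.exists_isUniform hG.no_infinite_direct_sum
  obtain ⟨a, haU, ha⟩ := hU.exists_mul_self_ne_zero
  have hdom : ∀ x y, a * x * a * y * a = 0 → a * x * a = 0 ∨ a * y * a = 0 :=
    fun x y => hU.eq_zero_of_mul_eq_zero haU
  by_cases hu : IsUnit a ∧ a ∈ Subring.center R
  · have : NoZeroDivisors R := ⟨by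
      intro x y hxy
      have hcomm := Subring.mem_center_iff.1 hu.2
      have h : a * x * a * y * a = 0 := by
        rw [mul_assoc a x a, hcomm x, ← mul_assoc, mul_assoc (a * a), hxy, mul_zero, zero_mul]
      simpa [hu.1.mul_left_eq_zero, hu.1.mul_right_eq_zero] using hdom x y h⟩
    exact hN.isField
  · obtain ⟨b, c, hb, hc, h⟩ := hN a hu
    exact absurd (mul_self_eq_zero_of_eq_add_nilpotent hdom hb hc h) ha
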